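/- Call a map $F:\mathbb{R}^n\to\mathbb{R}^n$ *everywhere defined rational* if each of its components is a quotient of two real polynomials with nowhere vanishing denominator, and *nonsingular* if its Jacobian matrix exists and is invertible at every point of $\mathbb{R}^n$. *Segre equivalence* is the equivalence relation, on the set of all real analytic maps $F:\mathbb{R}^n\to\mathbb{R}^n$ ($n>0$ arbitrary) with $F(0)=0$, generated by declaring each such $F:\mathbb{R}^n\to\mathbb{R}^n$ equivalent to $G:\mathbb{R}^{n+1}\to\mathbb{R}^{n+1}$, $G(x,t)=(F(tx)/t,\,t)$, where for $t=0$ the quotient $F(tx)/t$ is read as its limit $F'(0)x$. For an everywhere defined rational nonsingular map $F:\mathbb{R}^n\to\mathbb{R}^n$, let $\mathbb{R}(X)$ be the field of rational functions in $X=(x_1,\dots,x_n)$ and let $\mathbb{R}(F)\subseteq\mathbb{R}(X)$ be the subfield generated over $\mathbb{R}$ by the components of $F$. Let $\mathrm{dex}(F)$ be the degree of the extension $\mathbb{R}(X)/\mathbb{R}(F)$, let $\mathrm{sag}(F)$ be the size of the group of field automorphisms of $\mathbb{R}(X)$ fixing every element of $\mathbb{R}(F)$, and let $\mathrm{mfs}(F)$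 be the maximum over $y\in\mathbb{R}^n$ of the number of elements of the fiber $F^{-1}(y)$. **Theorem.** Let $F:\mathbb{R}^n\to\mathbb{R}^n$ and $G:\mathbb{R}^m\to\mathbb{R}^m$ ($n,m>0$) be real analytic maps with $F(0)=0$ and $G(0)=0$, and assume that they are Segre equivalent. Then $F$ is an everywhere defined rational nonsingular map if and only if $G$ is. Moreover, if this is the case, then $\mathrm{dex}(F)=\mathrm{dex}(G)$, $\mathrm{sag}(F)=\mathrm{sag}(G)$ and $\mathrm{mfs}(F)=\mathrm{mfs}(G)$. -/

import Mathlib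

namespace RealMap

/-- The field `ℝ(X)` of rational functions in `n` variables. -/
abbrev RationalFunctions (n : ℕ) : Type := FractionRing (MvPolynomial (Fin n) ℝ)

/-- The rational function `r` represents the function `g : ℝⁿ → ℝ` everywhere: `r` is a quotient
`p / q` of polynomials such that `q` vanishes nowhere on `ℝⁿ` and `g x = p x / q x` for all `x`. -/
def Represents {n : ℕ} (r : RationalFunctions n) (g : (Fin n → ℝ) → ℝ) : Prop :=
  ∃ p q : MvPolynomial (Fin n) ℝ,
    (∀ x, MvPolynomial.eval x q ≠ 0) ∧
    (∀ x, g x = MvPolynomial.eval x p / MvPolynomial.eval x q) ∧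
    r = algebraMap (MvPolynomial (Fin n) ℝ) (RationalFunctions n) p /
      algebraMap (MvPolynomial (Fin n) ℝ) (RationalFunctions n) q

/-- A function on `ℝⁿ` is represented by at most one rational function. -/
theorem Represents.unique {n : ℕ} {r s : RationalFunctions n} {g : (Fin n → ℝ) → ℝ}
    (hr : Represents r g) (hs : Represents s g) : r = s := by
  obtain ⟨p, q, hq, hg, rfl⟩ := hr
  obtain ⟨p', q', hq', hg', rfl⟩ := hs
  have h0 : ∀ a : MvPolynomial (Fin n) ℝ, (∀ x, MvPolynomial.eval x a ≠ 0) →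
      algebraMap (MvPolynomial (Fin n) ℝ) (RationalFunctions n) a ≠ 0 := by
    intro a ha h
    have h' : a = 0 := (IsFractionRing.injective (MvPolynomial (Fin n) ℝ) (RationalFunctions n))
      (by rw [h, map_zero])
    exact ha 0 (by rw [h', map_zero])
  rw [div_eq_div_iff (h0 q hq) (h0 q' hq'), ← map_mul, ← map_mul]
  congr 1
  apply MvPolynomial.funext
  intro x
  have h := (hg x).symm.trans (hg' x)
  rw [div_eq_div_iff (hq x) (hq' x)] at h
  rw [map_mul, map_mul, h]

/-- `F : ℝⁿ → ℝⁿ` is an everywhere defined rational map: each component is a quotient of two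
polynomials with nowhere vanishing denominator. -/
def IsEverywhereDefinedRational {n : ℕ} (F : (Fin n → ℝ) → (Fin n → ℝ)) : Prop :=
  ∀ i, ∃ r : RationalFunctions n, Represents r (fun x => F x i)

/-- `F : ℝⁿ → ℝⁿ` is nonsingular: its Jacobian exists and has nonzero determinant everywhere. -/
def IsNonsingular {n : ℕ} (F : (Fin n → ℝ) → (Fin n → ℝ)) : Prop :=
  Differentiable ℝ F ∧ ∀ x, (fderiv ℝ F x).det ≠ 0

/-- The subfield `ℝ(F)` of `ℝ(X)` generated over `ℝ` by the components of `F`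
(meant for everywhere defined rational maps `F`). -/
noncomputable def componentField {n : ℕ} (F : (Fin n → ℝ) → (Fin n → ℝ)) :
    IntermediateField ℝ (RationalFunctions n) :=
  IntermediateField.adjoin ℝ {r | ∃ i, Represents r (fun x => F x i)}

/-- `dex`: the degree of the field extension `ℝ(X) / ℝ(F)`. -/
noncomputable def dex {n : ℕ} (F : (Fin n → ℝ) → (Fin n → ℝ)) : Cardinal :=
  Module.rank (componentField F) (RationalFunctions n)

/-- `sag`: the size of the automorphism group of the field extension `ℝ(X) / ℝ(F)`. -/
noncomputable def sag {n : ℕ} (F : (Fin n → ℝ) → (Fin n → ℝ)) : Cardinal :=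
  Cardinal.mk (RationalFunctions n ≃ₐ[componentField F] RationalFunctions n)

/-- `mfs`: the maximum fiber size of `F`. -/
noncomputable def mfs {n : ℕ} (F : (Fin n → ℝ) → (Fin n → ℝ)) : ℕ∞ :=
  ⨆ y, (F ⁻¹' {y}).encard

/-- The map `G (x, t) = (F (t x) / t, t)` of `ℝⁿ⁺¹` into itself; for `t = 0` the expression
`F (t x) / t` denotes its limit, which is `F' (0) x` when `F` is differentiable with `F 0 = 0`. -/
noncomputable def segreMap {n : ℕ} (F : (Fin n → ℝ) → (Fin n → ℝ)) :
    (Fin (n + 1) → ℝ) → (Fin (n + 1) → ℝ) := fun z =>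
  let x : Fin n → ℝ := Fin.init z
  let t : ℝ := z (Fin.last n)
  Fin.snoc (α := fun _ => ℝ) (if t = 0 then fderiv ℝ F 0 x else t⁻¹ • F (t • x)) t

/-- The real analytic maps `ℝⁿ → ℝⁿ`, `n > 0`, that send `0` to `0`, in all dimensions `n`. -/
structure AnalyticEndo where
  dim : ℕ
  dim_pos : 0 < dim
  map : (Fin dim → ℝ) → (Fin dim → ℝ)
  analytic : AnalyticOnNhd ℝ map Set.univ
  map_zero : map 0 = 0

/-- The generating relation of Segre equivalence: `F` is related to `segreMap F`. -/
inductive SegreStep : AnalyticEndo → AnalyticEndo → Prop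
  | step (F : AnalyticEndo) (hpos : 0 < F.dim + 1)
      (han : AnalyticOnNhd ℝ (segreMap F.map) Set.univ) (hzero : segreMap F.map 0 = 0) :
      SegreStep F ⟨F.dim + 1, hpos, segreMap F.map, han, hzero⟩

/-- Segre equivalence: the equivalence relation generated by `SegreStep`. -/
def SegreEquivalent : AnalyticEndo → AnalyticEndo → Prop :=
  Relation.EqvGen SegreStep

end RealMap

/-! ### Adjoining a variable to an algebraic extension `K / k`: degree and automorphisms of `K(X) /
k(X)`. -/

namespace RatFunc

open _root_.IntermediateField

variable {R K : Type*} [Field R] [Field K] [Algebra R K]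

/-! It suffices to compare `F` with `G = segreMap F`; the equivalence relation follows by induction.

On the slice `t = 1` the map `G` is `F` itself, and for `t ≠ 0` it is `F` conjugated by a scaling;
at `t = 0` it is the linear map `F'(0)`. The Jacobian of `G` at `(x, t)` is block triangular with
blocks `F'(tx)` and `1`, so nonsingularity passes both ways, and each nonempty fiber of `G` injects
into one of `F` and conversely (`mfs_segreMap`). Rationality goes up because `F(0) = 0` makes the
numerator of `F(tx)` divisible by `t`, and down by setting `t = 1`.

For the field invariants, the substitution `xᵢ ↦ xᵢ / t` is an isomorphism `ℝ(X, t) ≃ ℝ(X)(t)`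
carrying `ℝ(G)` onto `ℝ(F)(t)` (`map_componentField_segreMap`). Since `F'(0)` is invertible, `ℝ(X) /
ℝ(F)` is algebraic (`isAlgebraic_componentField`), and adjoining a variable to both fields of an
algebraic extension changes neither the degree (`rank_adjoinX`) nor the automorphism group
(`extendAut_bijective`). -/

theorem adjoin_insert_X_range_C :
    adjoin R (insert (X : RatFunc K) (Set.range (C : K →+* RatFunc K))) = ⊤ := by
  rw [eq_top_iff]
  rintro f -
  set N := adjoin R (insert (X : RatFunc K) (Set.range (C : K →+* RatFunc K)))
  have hp : ∀ p : Polynomial K, algebraMap (Polynomial K) (RatFunc K) p ∈ N := by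
    intro p
    induction p using Polynomial.induction_on' with
    | add p q hp hq => rw [map_add]; exact add_mem hp hq
    | monomial m a =>
      rw [← Polynomial.C_mul_X_pow_eq_monomial, map_mul, map_pow, algebraMap_C, algebraMap_X]
      exact mul_mem (subset_adjoin _ _ (Set.mem_insert_of_mem _ ⟨a, rfl⟩))
        (pow_mem (subset_adjoin _ _ (Set.mem_insert _ _)) _)
  rw [← f.num_div_denom]
  exact div_mem (hp _) (hp _)

/-- The subfield `k(X)` of `K(X)`, for an intermediate field `k` of `K / R`. -/
noncomputable def adjoinX (k : IntermediateField R K) : IntermediateField R (RatFunc K) :=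
  adjoin R (insert X (C '' (k : Set K)))

theorem X_mem_adjoinX (k : IntermediateField R K) : (X : RatFunc K) ∈ adjoinX k :=
  subset_adjoin _ _ (Set.mem_insert _ _)

theorem C_mem_adjoinX {k : IntermediateField R K} {a : K} (ha : a ∈ k) : C a ∈ adjoinX k :=
  subset_adjoin _ _ (Set.mem_insert_of_mem _ ⟨a, ha, rfl⟩)

/-- The embedding `C` carries the field generated by `S` to the field generated by `C '' S`. This
lets `ℝ(F)(t)` be compared with other fields through generators. -/
theorem adjoinX_adjoin (S : Set K) :
    adjoinX (adjoin R S) = adjoin R (insert X (C '' S)) := by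
  apply le_antisymm
  · refine adjoin_le_iff.2 (Set.insert_subset (subset_adjoin _ _ (Set.mem_insert _ _)) ?_)
    have h := adjoin_map R S (IsScalarTower.toAlgHom R K (RatFunc K))
    have h' : (IsScalarTower.toAlgHom R K (RatFunc K) : K → RatFunc K) = C := by
      ext a; simp [algebraMap_eq_C]
    rw [h'] at h
    have h2 : C '' (adjoin R S : Set K) = (adjoin R (C '' S) : Set (RatFunc K)) := by
      rw [← h, coe_map, h']
    rw [h2]
    exact adjoin.mono _ _ _ (Set.subset_insert _ _)
  · exact adjoin.mono _ _ _ (Set.insert_subset_insert (Set.image_mono (subset_adjoin _ _)))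

section rank

attribute [local instance] Polynomial.algebra
open scoped RatFunc

/-- For algebraic `K / k`, a `k`-basis of `K` is a `k(X)`-basis of `K(X)`; this is
`rank_ratFunc_ratFunc`. What remains is to identify the abstract field `RatFunc k` with its image
`adjoinX k`. -/
theorem rank_adjoinX (k : IntermediateField R K) [Algebra.IsAlgebraic k K] :
    Module.rank (adjoinX k) (RatFunc K) = Module.rank k K := by
  rw [← rank_ratFunc_ratFunc k K]
  have hC : ∀ a : k, algebraMap (RatFunc k) (RatFunc K) (C a) = C (a : K) := by
    intro a
    rw [← algebraMap_C, ← IsScalarTower.algebraMap_apply (Polynomial k) (RatFunc k), ← algebraMap_C,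
      IsScalarTower.algebraMap_apply (Polynomial k) (Polynomial K) (RatFunc K)]
    simp [Polynomial.algebraMap_def]
  have hX : algebraMap (RatFunc k) (RatFunc K) X = X := by
    rw [← algebraMap_X, ← IsScalarTower.algebraMap_apply (Polynomial k) (RatFunc k), ← algebraMap_X,
      IsScalarTower.algebraMap_apply (Polynomial k) (Polynomial K) (RatFunc K)]
    simp [Polynomial.algebraMap_def]
  let f : RatFunc k →ₐ[R] RatFunc K :=
    { algebraMap (RatFunc k) (RatFunc K) with
      commutes' := fun r => by
        have := hC (algebraMap R k r)
        rw [← algebraMap_eq_C, ← algebraMap_eq_C, ← IsScalarTower.algebraMap_apply R k (RatFunc k)] at this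
        refine this.trans ?_
        rw [IsScalarTower.algebraMap_apply R K (RatFunc K)]
        rfl }
  have hf : f.fieldRange = adjoinX k := by
    rw [AlgHom.fieldRange_eq_map, ← adjoin_insert_X_range_C, adjoin_map, adjoinX,
      Set.image_insert_eq]
    congr 2
    rw [← Set.range_comp]
    ext z
    constructor
    · rintro ⟨a, rfl⟩
      exact ⟨a, a.2, (hC a).symm⟩
    · rintro ⟨a, ha, rfl⟩
      exact ⟨⟨a, ha⟩, hC ⟨a, ha⟩⟩
  let i : RatFunc k ≃ₐ[R] adjoinX k :=
    (AlgEquiv.ofInjectiveField f).trans (IntermediateField.equivOfEq hf)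
  exact (Algebra.rank_eq_of_equiv_equiv i.toRingEquiv (RingEquiv.refl (RatFunc K)) rfl).symm

end rank

section automorphisms

variable (k : IntermediateField R K)

/-- An automorphism of `K / k` extends to `K(X) / k(X)`. -/
noncomputable def extendAut (τ : K ≃ₐ[k] K) : RatFunc K ≃ₐ[adjoinX k] RatFunc K :=
  let e : RatFunc K ≃+* RatFunc K :=
    IsFractionRing.ringEquivOfRingEquiv (Polynomial.mapEquiv τ.toRingEquiv)
  have hC : ∀ a, e (C a) = C (τ a) := fun a => by
    rw [← algebraMap_C, IsFractionRing.ringEquivOfRingEquiv_algebraMap]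
    simp
  have hX : e X = X := by
    rw [← algebraMap_X, IsFractionRing.ringEquivOfRingEquiv_algebraMap]
    simp
  { e with
    commutes' := by
      rintro ⟨f, hf⟩
      change e f = f
      refine adjoin_induction (F := R) (p := fun f _ => e f = f) ?_ ?_ ?_ ?_ ?_ hf
      · rintro _ (rfl | ⟨a, ha, rfl⟩)
        · exact hX
        · rw [hC]
          exact congrArg C (τ.commutes ⟨a, ha⟩)
      · intro r
        rw [IsScalarTower.algebraMap_apply R K (RatFunc K), algebraMap_eq_C, hC]
        exact congrArg C (τ.commutes (algebraMap R k r))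
      · intro x y _ _ hx hy
        rw [map_add, hx, hy]
      · intro x _ hx
        rw [map_inv₀, hx]
      · intro x y _ _ hx hy
        rw [map_mul, hx, hy] }

theorem extendAut_C (τ : K ≃ₐ[k] K) (a : K) : extendAut k τ (C a) = C (τ a) := by
  change (IsFractionRing.ringEquivOfRingEquiv (Polynomial.mapEquiv τ.toRingEquiv) :
    RatFunc K ≃+* RatFunc K) (C a) = _
  rw [← algebraMap_C, IsFractionRing.ringEquivOfRingEquiv_algebraMap]
  simp

/-- An automorphism over `k(X)` fixes `X` and sends a constant, which is algebraic over `k`, to an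
algebraic element. Nonconstant elements of `K(X)` are transcendental over `K`, so constants go to
constants: the automorphism restricts to `K` and is determined by that restriction. -/
theorem extendAut_bijective [Algebra.IsAlgebraic k K] : Function.Bijective (extendAut k) := by
  constructor
  · intro τ τ' h
    ext a
    exact C.injective (by rw [← extendAut_C, ← extendAut_C, h])
  · intro σ
    have hfix : ∀ a ∈ k, σ (C a) = C a := fun a ha => σ.commutes ⟨C a, C_mem_adjoinX ha⟩
    have hσX : σ X = X := σ.commutes ⟨X, X_mem_adjoinX k⟩
    let σ' : RatFunc K →ₐ[k] RatFunc K :=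
      { (σ : RatFunc K →+* RatFunc K) with
        commutes' := fun a => by
          rw [IsScalarTower.algebraMap_apply k K (RatFunc K), algebraMap_eq_C]
          exact hfix _ a.2 }
    have hc : ∀ a : K, ∃ c, σ (C a) = C c := by
      intro a
      by_contra h
      refine transcendental_of_ne_C _ h ?_
      have h1 : IsAlgebraic k (σ' (algebraMap K (RatFunc K) a)) :=
        ((Algebra.IsAlgebraic.isAlgebraic (R := k) a).algebraMap).algHom σ'
      exact h1.extendScalars (algebraMap k K).injective
    choose τ hτ using hc
    let τ' : K →ₐ[k] K :=
      { toFun := τ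
        map_one' := C.injective (by rw [← hτ]; simp)
        map_mul' := fun a b => C.injective (by rw [← hτ]; simp [hτ])
        map_zero' := C.injective (by rw [← hτ]; simp)
        map_add' := fun a b => C.injective (by rw [← hτ]; simp [hτ])
        commutes' := fun a => C.injective (by rw [← hτ]; exact hfix _ a.2) }
    -- Every endomorphism of an algebraic extension is an automorphism, so `τ'` needs no separate
    -- inverse.
    refine ⟨AlgEquiv.ofBijective τ' (Algebra.IsAlgebraic.algHom_bijective τ'), ?_⟩
    apply AlgEquiv.ext
    intro f
    have hf : f ∈ adjoin R (insert (X : RatFunc K) (Set.range (C : K →+* RatFunc K))) := by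
      rw [adjoin_insert_X_range_C]; trivial
    set e := extendAut k (AlgEquiv.ofBijective τ' (Algebra.IsAlgebraic.algHom_bijective τ'))
    have heC : ∀ a, e (C a) = σ (C a) := fun a => by
      rw [extendAut_C, hτ]; rfl
    refine adjoin_induction (F := R) (p := fun f _ => e f = σ f) ?_ ?_ ?_ ?_ ?_ hf
    · rintro _ (rfl | ⟨a, rfl⟩)
      · rw [hσX]
        exact e.commutes ⟨X, X_mem_adjoinX k⟩
      · exact heC a
    · intro r
      rw [IsScalarTower.algebraMap_apply R K (RatFunc K), algebraMap_eq_C, heC]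
    · intro x y _ _ hx hy
      rw [map_add, map_add, hx, hy]
    · intro x _ hx
      rw [map_inv₀, map_inv₀, hx]
    · intro x y _ _ hx hy
      rw [map_mul, map_mul, hx, hy]

end automorphisms

end RatFunc

/-! ### Transport of degree and automorphisms along a field isomorphism. -/

namespace IntermediateField

variable {R L L' : Type*} [Field R] [Field L] [Field L'] [Algebra R L] [Algebra R L']

/-- An isomorphism `L ≃ L'` carrying `M` to `M'` carries automorphisms over `M` to automorphisms
over `M'`. -/
def autEquivOfMapEq (e : L ≃ₐ[R] L') {M : IntermediateField R L} {M' : IntermediateField R L'}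
    (h : M.map (e : L →ₐ[R] L') = M') : (L ≃ₐ[M] L) ≃ (L' ≃ₐ[M'] L') where
  toFun σ := AlgEquiv.ofRingEquiv (f := (e.symm.toRingEquiv.trans σ.toRingEquiv).trans e.toRingEquiv)
    (by
      rintro ⟨x, hx⟩
      subst h
      obtain ⟨y, hy, rfl⟩ := hx
      have := σ.commutes ⟨y, hy⟩
      change σ y = y at this
      change e (σ (e.symm (e y))) = e y
      rw [e.symm_apply_apply, this])
  invFun σ := AlgEquiv.ofRingEquiv (f := (e.toRingEquiv.trans σ.toRingEquiv).trans e.symm.toRingEquiv)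
    (by
      rintro ⟨x, hx⟩
      subst h
      have := σ.commutes ⟨e x, x, hx, rfl⟩
      change σ (e x) = e x at this
      change e.symm (σ (e x)) = x
      rw [this, e.symm_apply_apply])
  left_inv σ := by
    ext x
    change e.symm (e (σ (e.symm (e x)))) = σ x
    simp
  right_inv σ := by
    ext x
    change e (e.symm (σ (e (e.symm x)))) = σ x
    simp

/-- The types are bound afresh so that `L` and `L'` share a universe, as an equality of cardinals
requires. -/
theorem rank_eq_of_map_eq {R L L' : Type _} [Field R] [Field L] [Field L'] [Algebra R L]
    [Algebra R L'] (e : L ≃ₐ[R] L') {M : IntermediateField R L} {M' : IntermediateField R L'}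
    (h : M.map (e : L →ₐ[R] L') = M') : Module.rank M L = Module.rank M' L' := by
  subst h
  exact Algebra.rank_eq_of_equiv_equiv (intermediateFieldMap e M).toRingEquiv e.toRingEquiv rfl

end IntermediateField

namespace RealMap

open IntermediateField

/-! ### Rational functions representing real functions -/

theorem algebraMap_ne_zero_of_eval_ne_zero {n : ℕ} {q : MvPolynomial (Fin n) ℝ}
    (hq : ∀ x, MvPolynomial.eval x q ≠ 0) :
    algebraMap (MvPolynomial (Fin n) ℝ) (RationalFunctions n) q ≠ 0 := by
  intro h
  have h' : q = 0 := IsFractionRing.injective (MvPolynomial (Fin n) ℝ) (RationalFunctions n)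
    (by rw [h, map_zero])
  exact hq 0 (by rw [h', map_zero])

/-- Counterpart of `Represents.unique`; it turns an algebraic relation between rational functions
into a pointwise identity. -/
theorem Represents.fun_unique {n : ℕ} {r : RationalFunctions n} {f g : (Fin n → ℝ) → ℝ}
    (hf : Represents r f) (hg : Represents r g) : f = g := by
  obtain ⟨p, q, hq, hf, h⟩ := hf
  obtain ⟨p', q', hq', hg, h'⟩ := hg
  rw [h, div_eq_div_iff (algebraMap_ne_zero_of_eval_ne_zero hq)
    (algebraMap_ne_zero_of_eval_ne_zero hq'), ← map_mul, ← map_mul] at h'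
  have hpq := IsFractionRing.injective (MvPolynomial (Fin n) ℝ) (RationalFunctions n) h'
  funext x
  rw [hf, hg, div_eq_div_iff (hq x) (hq' x), ← map_mul, ← map_mul, hpq]

theorem represents_algebraMap {n : ℕ} (p : MvPolynomial (Fin n) ℝ) :
    Represents (algebraMap (MvPolynomial (Fin n) ℝ) (RationalFunctions n) p)
      (fun x => MvPolynomial.eval x p) :=
  ⟨p, 1, by simp, by simp, by simp⟩

theorem Represents.add {n : ℕ} {r s : RationalFunctions n} {f g : (Fin n → ℝ) → ℝ}
    (hr : Represents r f) (hs : Represents s g) : Represents (r + s) (fun x => f x + g x) := by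
  obtain ⟨p, q, hq, hf, rfl⟩ := hr
  obtain ⟨p', q', hq', hg, rfl⟩ := hs
  refine ⟨p * q' + q * p', q * q', fun x => ?_, fun x => ?_, ?_⟩
  · rw [map_mul]
    exact mul_ne_zero (hq x) (hq' x)
  · simp only [hf, hg]
    rw [div_add_div _ _ (hq x) (hq' x)]
    simp
  · rw [div_add_div _ _ (algebraMap_ne_zero_of_eval_ne_zero hq)
      (algebraMap_ne_zero_of_eval_ne_zero hq')]
    simp

theorem Represents.mul {n : ℕ} {r s : RationalFunctions n} {f g : (Fin n → ℝ) → ℝ}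
    (hr : Represents r f) (hs : Represents s g) : Represents (r * s) (fun x => f x * g x) := by
  obtain ⟨p, q, hq, hf, rfl⟩ := hr
  obtain ⟨p', q', hq', hg, rfl⟩ := hs
  refine ⟨p * p', q * q', fun x => ?_, fun x => ?_, ?_⟩
  · rw [map_mul]
    exact mul_ne_zero (hq x) (hq' x)
  · simp only [hf, hg]
    rw [div_mul_div_comm]
    simp
  · rw [div_mul_div_comm]
    simp

theorem represents_aeval {n : ℕ} {ι : Type*} {F : (Fin n → ℝ) → (ι → ℝ)}
    {r : ι → RationalFunctions n} (hr : ∀ i, Represents (r i) (fun x => F x i))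
    (P : MvPolynomial ι ℝ) :
    Represents (MvPolynomial.aeval r P) (fun x => MvPolynomial.eval (F x) P) := by
  induction P using MvPolynomial.induction_on with
  | C a =>
    have := represents_algebraMap (n := n) (MvPolynomial.C a)
    rw [← MvPolynomial.algebraMap_eq, ← IsScalarTower.algebraMap_apply] at this
    simpa using this
  | add p q hp hq => simpa only [map_add] using hp.add hq
  | mul_X p i hp => simpa only [map_mul, MvPolynomial.aeval_X, MvPolynomial.eval_X] using hp.mul (hr i)

theorem componentField_eq {n : ℕ} {F : (Fin n → ℝ) → (Fin n → ℝ)}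
    {r : Fin n → RationalFunctions n} (hr : ∀ i, Represents (r i) (fun x => F x i)) :
    componentField F = adjoin ℝ (Set.range r) := by
  rw [componentField]
  congr 1
  ext s
  constructor
  · rintro ⟨i, hi⟩
    exact ⟨i, (hr i).unique hi⟩
  · rintro ⟨i, rfl⟩
    exact ⟨i, hr i⟩

/-! ### Algebraicity of `ℝ(X) / ℝ(F)` -/

theorem trdeg_rationalFunctions (n : ℕ) : Algebra.trdeg ℝ (RationalFunctions n) = n := by
  rw [← trdeg_add_eq ℝ (MvPolynomial (Fin n) ℝ), MvPolynomial.trdeg_of_isDomain]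
  have : Algebra.IsAlgebraic (MvPolynomial (Fin n) ℝ) (RationalFunctions n) :=
    IsLocalization.isAlgebraic _ (nonZeroDivisors (MvPolynomial (Fin n) ℝ))
  rw [trdeg_eq_zero]
  simp

theorem _root_.RatFunc.trdeg_eq (R K : Type) [Field R] [Field K] [Algebra R K] :
    Algebra.trdeg R (RatFunc K) = Algebra.trdeg R K + 1 := by
  have : FaithfulSMul (Polynomial K) (RatFunc K) :=
    (faithfulSMul_iff_algebraMap_injective _ _).2 (IsFractionRing.injective _ _)
  have : Algebra.IsAlgebraic (Polynomial K) (RatFunc K) :=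
    IsLocalization.isAlgebraic _ (nonZeroDivisors (Polynomial K))
  rw [← trdeg_add_eq R K, ← trdeg_add_eq K (Polynomial K), Polynomial.trdeg_of_isDomain,
    trdeg_eq_zero (R := Polynomial K), add_zero]

/-- A ball in the sup norm is a product of infinite sets, and a polynomial vanishing on such a
product is zero. -/
theorem mvPolynomial_eq_zero_of_eventually {n : ℕ} {P : MvPolynomial (Fin n) ℝ} {y : Fin n → ℝ}
    (h : ∀ᶠ x in nhds y, MvPolynomial.eval x P = 0) : P = 0 := by
  obtain ⟨ε, hε, h⟩ := Metric.eventually_nhds_iff_ball.1 h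
  refine MvPolynomial.funext_set (fun i => Metric.ball (y i) ε) (fun i => ?_) fun x hx => ?_
  · rw [Real.ball_eq_Ioo]
    exact Set.Ioo_infinite (by linarith)
  · rw [h x (by rwa [← ball_pi y hε] at hx), map_zero]

theorem det_ne_zero_iff_injective {n : ℕ} (A : (Fin n → ℝ) →L[ℝ] (Fin n → ℝ)) :
    A.det ≠ 0 ↔ ∀ v, A v = 0 → v = 0 := by
  rw [ContinuousLinearMap.det, Ne, LinearMap.det_eq_zero_iff_ker_ne_bot, not_not,
    LinearMap.ker_eq_bot']
  rfl

/-- A polynomial relation `P` between the components gives `P ∘ F = 0`. As `F'(0)` is surjective,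
`F` maps neighborhoods of `0` onto neighborhoods of `F 0`, so `P` vanishes near `F 0` and is zero.
Thus the `n` components are independent, hence a transcendence basis of `ℝ(X)`. -/
theorem isAlgebraic_componentField {n : ℕ} {F : (Fin n → ℝ) → (Fin n → ℝ)}
    (hF : AnalyticOnNhd ℝ F Set.univ) {r : Fin n → RationalFunctions n}
    (hr : ∀ i, Represents (r i) (fun x => F x i)) (hdet : (fderiv ℝ F 0).det ≠ 0) :
    Algebra.IsAlgebraic (componentField F) (RationalFunctions n) := by
  have hind : AlgebraicIndependent ℝ r := by
    rw [algebraicIndependent_iff]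
    intro P hP
    have h0 := represents_aeval hr P
    rw [hP] at h0
    have h1 : Represents (0 : RationalFunctions n) (fun _ => (0 : ℝ)) := by
      simpa using represents_algebraMap (n := n) 0
    have h2 := congrFun (h0.fun_unique h1)
    have hsurj : ((fderiv ℝ F 0 : (Fin n → ℝ) →L[ℝ] (Fin n → ℝ)) :
        (Fin n → ℝ) →ₗ[ℝ] (Fin n → ℝ)).range = ⊤ := by
      rw [← LinearMap.ker_eq_bot_iff_range_eq_top, LinearMap.ker_eq_bot']
      exact (det_ne_zero_iff_injective _).1 hdet
    have hmap := (hF 0 trivial).hasStrictFDerivAt.map_nhds_eq_of_surj hsurj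
    refine mvPolynomial_eq_zero_of_eventually (y := F 0) ?_
    rw [← hmap, Filter.eventually_map]
    exact Filter.Eventually.of_forall h2
  have hb : IsTranscendenceBasis ℝ r :=
    hind.isTranscendenceBasis_of_trdeg_le_of_finite (by rw [trdeg_rationalFunctions]; simp)
  rw [componentField_eq hr]
  exact hb.isAlgebraic_field

/-! ### The field isomorphism attached to `(x, t) ↦ (t x, t)` -/

theorem adjoin_range_algebraMap_X (n : ℕ) :
    adjoin ℝ (Set.range fun i : Fin n =>
      algebraMap (MvPolynomial (Fin n) ℝ) (RationalFunctions n) (MvPolynomial.X i)) = ⊤ := by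
  rw [eq_top_iff]
  rintro f -
  set N := adjoin ℝ (Set.range fun i : Fin n =>
      algebraMap (MvPolynomial (Fin n) ℝ) (RationalFunctions n) (MvPolynomial.X i))
  have hp : ∀ p, algebraMap (MvPolynomial (Fin n) ℝ) (RationalFunctions n) p ∈ N := by
    intro p
    induction p using MvPolynomial.induction_on with
    | C a =>
      rw [← MvPolynomial.algebraMap_eq, ← IsScalarTower.algebraMap_apply]
      exact N.algebraMap_mem a
    | add p q hp hq => rw [map_add]; exact add_mem hp hq
    | mul_X p i hp => rw [map_mul]; exact mul_mem hp (subset_adjoin _ _ ⟨i, rfl⟩)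
  obtain ⟨p, q, -, rfl⟩ := IsFractionRing.div_surjective (MvPolynomial (Fin n) ℝ) f
  exact div_mem (hp p) (hp q)

/-- The generators `x₁ / t, …, xₙ / t, t` of `ℝ(X)(t)`. -/
noncomputable def rescaledVars (n : ℕ) : Fin (n + 1) → RatFunc (RationalFunctions n) :=
  Fin.snoc (α := fun _ => RatFunc (RationalFunctions n))
    (fun i => RatFunc.C (algebraMap (MvPolynomial (Fin n) ℝ) (RationalFunctions n)
      (MvPolynomial.X i)) / RatFunc.X) RatFunc.X

theorem rescaledVars_castSucc (n : ℕ) (i : Fin n) :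
    rescaledVars n i.castSucc = RatFunc.C (algebraMap (MvPolynomial (Fin n) ℝ)
      (RationalFunctions n) (MvPolynomial.X i)) / RatFunc.X := by
  simp [rescaledVars]

theorem rescaledVars_last (n : ℕ) : rescaledVars n (Fin.last n) = RatFunc.X := by
  simp [rescaledVars]

theorem adjoin_range_rescaledVars (n : ℕ) : adjoin ℝ (Set.range (rescaledVars n)) = ⊤ := by
  rw [eq_top_iff, ← RatFunc.adjoin_insert_X_range_C (R := ℝ) (K := RationalFunctions n)]
  have h := RatFunc.adjoinX_adjoin (R := ℝ) (K := RationalFunctions n) (Set.range fun i : Fin n =>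
      algebraMap (MvPolynomial (Fin n) ℝ) (RationalFunctions n) (MvPolynomial.X i))
  rw [adjoin_range_algebraMap_X, RatFunc.adjoinX, coe_top, Set.image_univ] at h
  rw [h, adjoin_le_iff]
  have hX : (RatFunc.X : RatFunc (RationalFunctions n)) ∈ adjoin ℝ (Set.range (rescaledVars n)) :=
    subset_adjoin _ _ ⟨Fin.last n, rescaledVars_last n⟩
  rintro _ (rfl | ⟨_, ⟨i, rfl⟩, rfl⟩)
  · exact hX
  · have := mul_mem (subset_adjoin ℝ (Set.range (rescaledVars n))
      ⟨i.castSucc, rescaledVars_castSucc n i⟩) hX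
    rwa [div_mul_cancel₀ _ RatFunc.X_ne_zero] at this

/-- These `n + 1` elements generate a field of transcendence degree `n + 1`, so they cannot be
dependent. -/
theorem algebraicIndependent_rescaledVars (n : ℕ) : AlgebraicIndependent ℝ (rescaledVars n) := by
  have h1 : Algebra.IsAlgebraic (adjoin ℝ (Set.range (rescaledVars n)))
      (RatFunc (RationalFunctions n)) := by
    rw [adjoin_range_rescaledVars]
    exact ⟨fun x => isAlgebraic_algebraMap (A := RatFunc (RationalFunctions n))
      (⟨x, mem_top⟩ : (⊤ : IntermediateField ℝ (RatFunc (RationalFunctions n))))⟩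
  have h2 : Algebra.IsAlgebraic (Algebra.adjoin ℝ (Set.range (rescaledVars n)))
      (RatFunc (RationalFunctions n)) := by
    open algebraAdjoinAdjoin in
    exact Algebra.IsAlgebraic.trans _ (adjoin ℝ (Set.range (rescaledVars n))) _
  exact (Algebra.IsAlgebraic.isTranscendenceBasis_of_le_trdeg_of_finite ℝ (rescaledVars n)
    (by rw [RatFunc.trdeg_eq, trdeg_rationalFunctions]; simp)).1

/-- The homomorphism `ℝ(X, t) → ℝ(X)(t)` given by `xᵢ ↦ xᵢ / t` and `t ↦ t`. -/
noncomputable def rescaleHom (n : ℕ) :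
    RationalFunctions (n + 1) →ₐ[ℝ] RatFunc (RationalFunctions n) :=
  IsFractionRing.liftAlgHom (g := MvPolynomial.aeval (rescaledVars n))
    (algebraicIndependent_iff_injective_aeval.1 (algebraicIndependent_rescaledVars n))

theorem rescaleHom_algebraMap (n : ℕ) (p : MvPolynomial (Fin (n + 1)) ℝ) :
    rescaleHom n (algebraMap _ _ p) = MvPolynomial.aeval (rescaledVars n) p :=
  IsFractionRing.lift_algebraMap (algebraicIndependent_iff_injective_aeval.1
    (algebraicIndependent_rescaledVars n)) p

theorem rescaleHom_bijective (n : ℕ) : Function.Bijective (rescaleHom n) := by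
  refine ⟨(rescaleHom n).toRingHom.injective, ?_⟩
  rw [← AlgHom.fieldRange_eq_top, eq_top_iff, ← adjoin_range_rescaledVars, adjoin_le_iff]
  rintro _ ⟨i, rfl⟩
  exact ⟨algebraMap (MvPolynomial (Fin (n + 1)) ℝ) _ (MvPolynomial.X i),
    (rescaleHom_algebraMap n _).trans (MvPolynomial.aeval_X _ _)⟩

/-- The isomorphism `ℝ(X, t) ≃ ℝ(X)(t)` given by `xᵢ ↦ xᵢ / t` and `t ↦ t`. -/
noncomputable def rescaleEquiv (n : ℕ) :
    RationalFunctions (n + 1) ≃ₐ[ℝ] RatFunc (RationalFunctions n) :=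
  AlgEquiv.ofBijective (rescaleHom n) (rescaleHom_bijective n)

theorem rescaleEquiv_algebraMap (n : ℕ) (p : MvPolynomial (Fin (n + 1)) ℝ) :
    rescaleEquiv n (algebraMap _ _ p) = MvPolynomial.aeval (rescaledVars n) p :=
  rescaleHom_algebraMap n p

/-- The substitution `xᵢ ↦ t xᵢ`. -/
noncomputable def scaleVars (n : ℕ) : MvPolynomial (Fin n) ℝ →ₐ[ℝ] MvPolynomial (Fin (n + 1)) ℝ :=
  MvPolynomial.aeval fun i => MvPolynomial.X (Fin.last n) * MvPolynomial.X i.castSucc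

theorem eval_scaleVars {n : ℕ} (p : MvPolynomial (Fin n) ℝ) (z : Fin (n + 1) → ℝ) :
    MvPolynomial.eval z (scaleVars n p) = MvPolynomial.eval (z (Fin.last n) • Fin.init z) p := by
  induction p using MvPolynomial.induction_on with
  | C a => simp [scaleVars]
  | add p q hp hq => rw [map_add, map_add, map_add, hp, hq]
  | mul_X p i hp => rw [map_mul, map_mul, map_mul, hp]; simp [scaleVars, Fin.init]

/-- The substitutions `xᵢ ↦ t xᵢ` and `xᵢ ↦ xᵢ / t` cancel, so `p(tx)` becomes free of `t`. -/
theorem aeval_rescaledVars_scaleVars {n : ℕ} (p : MvPolynomial (Fin n) ℝ) :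
    MvPolynomial.aeval (rescaledVars n) (scaleVars n p) =
      RatFunc.C (algebraMap (MvPolynomial (Fin n) ℝ) (RationalFunctions n) p) := by
  induction p using MvPolynomial.induction_on with
  | C a =>
    rw [← MvPolynomial.algebraMap_eq, AlgHom.commutes, AlgHom.commutes,
      ← IsScalarTower.algebraMap_apply ℝ, ← RatFunc.algebraMap_eq_C, ← IsScalarTower.algebraMap_apply]
  | add p q hp hq => simp only [map_add, hp, hq]
  | mul_X p i hp =>
    rw [map_mul, map_mul, hp, map_mul, map_mul]
    congr 1
    simp only [scaleVars, MvPolynomial.aeval_X, map_mul, rescaledVars_castSucc, rescaledVars_last]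
    exact mul_div_cancel₀ _ RatFunc.X_ne_zero

/-- Modulo `t`, `p(tx)` is `p(0)`. When `p(0) = 0`, this makes `p(tx) / t` a polynomial. -/
theorem X_last_dvd_scaleVars {n : ℕ} (p : MvPolynomial (Fin n) ℝ) :
    MvPolynomial.X (Fin.last n) ∣ scaleVars n p - MvPolynomial.C (MvPolynomial.eval 0 p) := by
  induction p using MvPolynomial.induction_on with
  | C a => simp [scaleVars]
  | add p q hp hq =>
    convert dvd_add hp hq using 1
    simp only [map_add]
    ring
  | mul_X p i hp =>
    refine ⟨scaleVars n p * MvPolynomial.X i.castSucc, ?_⟩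
    simp [scaleVars]
    ring

end RealMap

/-! ### Comparison of `F` with `segreMap F`. -/

namespace RealMap

open Filter Topology

variable {n : ℕ} {F : (Fin n → ℝ) → (Fin n → ℝ)}

theorem segreMap_last (F : (Fin n → ℝ) → (Fin n → ℝ)) (z : Fin (n + 1) → ℝ) :
    segreMap F z (Fin.last n) = z (Fin.last n) := by
  simp [segreMap]

theorem segreMap_castSucc_of_ne {z : Fin (n + 1) → ℝ} (h : z (Fin.last n) ≠ 0) (i : Fin n) :
    segreMap F z i.castSucc = (z (Fin.last n))⁻¹ * F (z (Fin.last n) • Fin.init z) i := by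
  simp [segreMap, h]

theorem segreMap_castSucc_of_eq {z : Fin (n + 1) → ℝ} (h : z (Fin.last n) = 0) (i : Fin n) :
    segreMap F z i.castSucc = fderiv ℝ F 0 (Fin.init z) i := by
  simp [segreMap, h]

theorem segreMap_snoc_one (F : (Fin n → ℝ) → (Fin n → ℝ)) (x : Fin n → ℝ) (i : Fin n) :
    segreMap F (Fin.snoc (α := fun _ => ℝ) x 1) i.castSucc = F x i := by
  rw [segreMap_castSucc_of_ne (by simp)]
  simp

/-! ### Everywhere defined rational maps -/

theorem tendsto_segre_quotient (h0 : F 0 = 0) (hd : DifferentiableAt ℝ F 0) (x : Fin n → ℝ)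
    (i : Fin n) :
    Tendsto (fun t : ℝ => t⁻¹ * F (t • x) i) (𝓝[≠] 0) (𝓝 (fderiv ℝ F 0 x i)) := by
  have h1 : HasDerivAt (fun t : ℝ => t • x) x 0 := by
    simpa using (hasDerivAt_id (0 : ℝ)).smul_const x
  have h2 : HasFDerivAt F (fderiv ℝ F 0) ((0 : ℝ) • x) := by
    rw [zero_smul]; exact hd.hasFDerivAt
  have h3 := hasDerivAt_pi.1 (h2.comp_hasDerivAt (0 : ℝ) h1) i
  simpa [h0] using hasDerivAt_iff_tendsto_slope_zero.1 h3

/-- If the component is `p / q`, then `p(0) = 0`, so `p(tx) = t P` and the new component is `P /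
q(tx)`, whose denominator still vanishes nowhere. Rescaling turns it into `r / t`. -/
theorem exists_represents_segreMap (h0 : F 0 = 0) (hd : DifferentiableAt ℝ F 0) {i : Fin n}
    {r : RationalFunctions n} (hr : Represents r (fun x => F x i)) :
    ∃ s : RationalFunctions (n + 1), Represents s (fun z => segreMap F z i.castSucc) ∧
      rescaleEquiv n s = RatFunc.C r / RatFunc.X := by
  obtain ⟨p, q, hq, hF, rfl⟩ := hr
  replace hF : ∀ x, F x i = MvPolynomial.eval x p / MvPolynomial.eval x q := hF
  have hp0 : MvPolynomial.eval 0 p = 0 := by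
    have := hF 0
    rw [h0, Pi.zero_apply, eq_comm, div_eq_zero_iff] at this
    exact this.resolve_right (hq 0)
  obtain ⟨P, hP⟩ := X_last_dvd_scaleVars p
  rw [hp0, MvPolynomial.C_0, sub_zero] at hP
  have hval : ∀ z : Fin (n + 1) → ℝ, z (Fin.last n) ≠ 0 →
      (z (Fin.last n))⁻¹ * F (z (Fin.last n) • Fin.init z) i =
        MvPolynomial.eval z P / MvPolynomial.eval z (scaleVars n q) := by
    intro z hz
    rw [hF, ← eval_scaleVars, ← eval_scaleVars, hP, map_mul, MvPolynomial.eval_X]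
    field_simp
  have hq' : ∀ z, MvPolynomial.eval z (scaleVars n q) ≠ 0 := fun z => by
    rw [eval_scaleVars]; exact hq _
  refine ⟨_, ⟨P, scaleVars n q, hq', fun z => ?_, rfl⟩, ?_⟩
  · by_cases hz : z (Fin.last n) = 0
    · change segreMap F z i.castSucc = _
      rw [segreMap_castSucc_of_eq hz]
      -- On the hyperplane `t = 0`, both sides are the limit of the same quotient as `t → 0`: one by
      -- differentiability, the other by continuity of `P / q(tx)`.
      refine tendsto_nhds_unique (tendsto_segre_quotient h0 hd (Fin.init z) i) ?_
      have hc : Continuous fun t : ℝ => (Fin.snoc (α := fun _ => ℝ) (Fin.init z) t) := by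
        refine continuous_pi fun j => ?_
        refine Fin.lastCases ?_ (fun j => ?_) j
        · simpa using continuous_id'
        · simpa using continuous_const
      have hg : Continuous fun t : ℝ =>
          MvPolynomial.eval (Fin.snoc (α := fun _ => ℝ) (Fin.init z) t) P /
            MvPolynomial.eval (Fin.snoc (α := fun _ => ℝ) (Fin.init z) t) (scaleVars n q) :=
        ((MvPolynomial.continuous_eval P).comp hc).div
          ((MvPolynomial.continuous_eval _).comp hc) fun t => hq' _
      have hlim := (hg.tendsto 0).mono_left (nhdsWithin_le_nhds (s := {0}ᶜ))
      have hz' : (Fin.snoc (α := fun _ => ℝ) (Fin.init z) (0 : ℝ)) = z := by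
        rw [← hz]; exact Fin.snoc_init_self z
      rw [hz'] at hlim
      refine hlim.congr' ?_
      filter_upwards [self_mem_nhdsWithin] with t ht
      have := hval (Fin.snoc (α := fun _ => ℝ) (Fin.init z) t) (by simpa using ht)
      rw [← this]
      simp
    · change segreMap F z i.castSucc = _
      rw [segreMap_castSucc_of_ne hz, hval z hz]
  · have h1 : RatFunc.X * MvPolynomial.aeval (rescaledVars n) P =
        RatFunc.C (algebraMap (MvPolynomial (Fin n) ℝ) (RationalFunctions n) p) := by
      rw [← aeval_rescaledVars_scaleVars, hP, map_mul, MvPolynomial.aeval_X, rescaledVars_last]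
    rw [map_div₀, rescaleEquiv_algebraMap, rescaleEquiv_algebraMap, aeval_rescaledVars_scaleVars,
      map_div₀, ← h1, div_right_comm, mul_div_cancel_left₀ _ RatFunc.X_ne_zero]

theorem represents_segreMap_last (F : (Fin n → ℝ) → (Fin n → ℝ)) :
    Represents (algebraMap (MvPolynomial (Fin (n + 1)) ℝ) (RationalFunctions (n + 1))
      (MvPolynomial.X (Fin.last n))) (fun z => segreMap F z (Fin.last n)) := by
  simpa only [segreMap_last, MvPolynomial.eval_X] using
    represents_algebraMap (MvPolynomial.X (Fin.last n) : MvPolynomial (Fin (n + 1)) ℝ)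

theorem isEverywhereDefinedRational_segreMap_iff (h0 : F 0 = 0) (hd : DifferentiableAt ℝ F 0) :
    IsEverywhereDefinedRational (segreMap F) ↔ IsEverywhereDefinedRational F := by
  constructor
  · intro h i
    obtain ⟨r, p, q, hq, hG, -⟩ := h i.castSucc
    -- Setting `t = 1` recovers `F` from its Segre map.
    let σ : MvPolynomial (Fin (n + 1)) ℝ →ₐ[ℝ] MvPolynomial (Fin n) ℝ :=
      MvPolynomial.aeval (Fin.snoc (α := fun _ => MvPolynomial (Fin n) ℝ) MvPolynomial.X 1)
    have hσ : ∀ (p : MvPolynomial (Fin (n + 1)) ℝ) (x : Fin n → ℝ), MvPolynomial.eval x (σ p) =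
        MvPolynomial.eval (Fin.snoc (α := fun _ => ℝ) x 1) p := by
      intro p x
      induction p using MvPolynomial.induction_on with
      | C a => simp [σ]
      | add p q hp hq => rw [map_add, map_add, map_add, hp, hq]
      | mul_X p j hp =>
        rw [map_mul, map_mul, map_mul, hp]
        congr 1
        refine Fin.lastCases ?_ (fun j => ?_) j <;> simp [σ]
    refine ⟨_, σ p, σ q, fun x => ?_, fun x => ?_, rfl⟩
    · rw [hσ]; exact hq _
    · rw [hσ, hσ, ← hG]
      exact (segreMap_snoc_one F x i).symm
  · intro h i
    refine Fin.lastCases ⟨_, represents_segreMap_last F⟩ (fun i => ?_) i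
    obtain ⟨r, hr⟩ := h i
    obtain ⟨s, hs, -⟩ := exists_represents_segreMap h0 hd hr
    exact ⟨s, hs⟩

/-! ### Nonsingularity -/

/-- The embedding `v ↦ (v, 0)`. -/
noncomputable def snocZero (n : ℕ) : (Fin n → ℝ) →L[ℝ] (Fin (n + 1) → ℝ) :=
  LinearMap.toContinuousLinearMap
    { toFun := fun v => Fin.snoc (α := fun _ => ℝ) v 0
      map_add' := fun v w => by
        ext j
        refine Fin.lastCases ?_ (fun j => ?_) j <;> simp
      map_smul' := fun c v => by
        ext j
        refine Fin.lastCases ?_ (fun j => ?_) j <;> simp }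

theorem snocZero_apply (v : Fin n → ℝ) : snocZero n v = Fin.snoc (α := fun _ => ℝ) v 0 := rfl

theorem fderiv_segreMap_last {z : Fin (n + 1) → ℝ} (hG : DifferentiableAt ℝ (segreMap F) z)
    (w : Fin (n + 1) → ℝ) : fderiv ℝ (segreMap F) z w (Fin.last n) = w (Fin.last n) := by
  have h1 := hasFDerivAt_pi'.1 hG.hasFDerivAt (Fin.last n)
  simp only [segreMap_last] at h1
  have h2 := h1.unique (ContinuousLinearMap.proj (R := ℝ) (φ := fun _ : Fin (n + 1) => ℝ)
    (Fin.last n)).hasFDerivAt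
  exact congrArg (fun A : (Fin (n + 1) → ℝ) →L[ℝ] ℝ => A w) h2

/-- For fixed `t ≠ 0` the factors `t` and `t⁻¹` cancel in the chain rule; for `t = 0` the slice is
the linear map `F'(0)`, its own derivative. -/
theorem fderiv_segreMap_snocZero {z : Fin (n + 1) → ℝ} (hF : Differentiable ℝ F)
    (hG : DifferentiableAt ℝ (segreMap F) z) (v : Fin n → ℝ) (i : Fin n) :
    fderiv ℝ (segreMap F) z (snocZero n v) i.castSucc =
      fderiv ℝ F (z (Fin.last n) • Fin.init z) v i := by
  have hin : HasFDerivAt (fun u : Fin n → ℝ => z + snocZero n u) (snocZero n) 0 :=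
    (snocZero n).hasFDerivAt.const_add z
  have h1 : HasFDerivAt (fun u => segreMap F (z + snocZero n u))
      ((fderiv ℝ (segreMap F) z).comp (snocZero n)) 0 := by
    refine HasFDerivAt.comp (g := segreMap F) 0 ?_ hin
    simpa using hG.hasFDerivAt
  have h2 := hasFDerivAt_pi'.1 h1 i.castSucc
  have hlast : ∀ u : Fin n → ℝ, (z + snocZero n u) (Fin.last n) = z (Fin.last n) := by
    intro u; simp [snocZero_apply]
  have hinit : ∀ u : Fin n → ℝ, Fin.init (z + snocZero n u) = Fin.init z + u := by
    intro u; ext j; simp [snocZero_apply, Fin.init]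
  have h3 : HasFDerivAt (fun u => segreMap F (z + snocZero n u) i.castSucc)
      ((ContinuousLinearMap.proj (R := ℝ) (φ := fun _ : Fin n => ℝ) i).comp
        (fderiv ℝ F (z (Fin.last n) • Fin.init z))) 0 := by
    by_cases hz : z (Fin.last n) = 0
    · have he : (fun u => segreMap F (z + snocZero n u) i.castSucc) =
          fun u => fderiv ℝ F 0 (Fin.init z) i + fderiv ℝ F 0 u i := by
        funext u
        rw [segreMap_castSucc_of_eq ((hlast u).trans hz), hinit, map_add, Pi.add_apply]
      rw [he, hz, zero_smul]
      exact ((ContinuousLinearMap.proj (R := ℝ) (φ := fun _ : Fin n => ℝ) i).comp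
        (fderiv ℝ F 0)).hasFDerivAt.const_add _
    · have he : (fun u => segreMap F (z + snocZero n u) i.castSucc) =
          fun u => (z (Fin.last n))⁻¹ * F (z (Fin.last n) • (Fin.init z + u)) i := by
        funext u
        rw [segreMap_castSucc_of_ne (by rwa [hlast]), hinit, hlast]
      rw [he]
      have h4 : HasFDerivAt (fun u : Fin n → ℝ => z (Fin.last n) • (Fin.init z + u))
          (z (Fin.last n) • ContinuousLinearMap.id ℝ (Fin n → ℝ)) 0 :=
        ((hasFDerivAt_id (𝕜 := ℝ) (0 : Fin n → ℝ)).const_add (Fin.init z)).const_smul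
          (z (Fin.last n))
      have h5 : HasFDerivAt (fun u : Fin n → ℝ => F (z (Fin.last n) • (Fin.init z + u)))
          ((fderiv ℝ F (z (Fin.last n) • Fin.init z)).comp
            (z (Fin.last n) • ContinuousLinearMap.id ℝ (Fin n → ℝ))) 0 := by
        refine HasFDerivAt.comp (g := F) 0 ?_ h4
        simpa using (hF _).hasFDerivAt
      have h6 := (hasFDerivAt_pi'.1 h5 i).const_mul (z (Fin.last n))⁻¹
      refine h6.congr_fderiv (ContinuousLinearMap.ext fun u => ?_)
      change (z (Fin.last n))⁻¹ * fderiv ℝ F (z (Fin.last n) • Fin.init z)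
        (z (Fin.last n) • u) i = fderiv ℝ F (z (Fin.last n) • Fin.init z) u i
      rw [map_smul, Pi.smul_apply, smul_eq_mul, inv_mul_cancel_left₀ hz]
  have h7 := h2.unique h3
  exact congrArg (fun A : (Fin n → ℝ) →L[ℝ] ℝ => A v) h7

/-- The Jacobian is block triangular. Comparing kernels avoids the `t`-derivative of `F(tx) / t`: a
kernel vector has last coordinate `0`. -/
theorem det_fderiv_segreMap_ne_zero_iff {z : Fin (n + 1) → ℝ} (hF : Differentiable ℝ F)
    (hG : DifferentiableAt ℝ (segreMap F) z) :
    (fderiv ℝ (segreMap F) z).det ≠ 0 ↔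
      (fderiv ℝ F (z (Fin.last n) • Fin.init z)).det ≠ 0 := by
  rw [det_ne_zero_iff_injective, det_ne_zero_iff_injective]
  constructor
  · intro h v hv
    have h1 : snocZero n v = 0 := by
      apply h
      ext j
      refine Fin.lastCases ?_ (fun j => ?_) j
      · rw [fderiv_segreMap_last hG]; simp [snocZero_apply]
      · rw [fderiv_segreMap_snocZero hF hG, hv]; rfl
    ext j
    have := congrFun h1 j.castSucc
    simpa [snocZero_apply] using this
  · intro h w hw
    have h0 : w (Fin.last n) = 0 := by
      rw [← fderiv_segreMap_last hG w, hw]; rfl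
    have hw' : snocZero n (Fin.init w) = w := by
      rw [snocZero_apply, ← h0]; exact Fin.snoc_init_self w
    have h1 : Fin.init w = 0 := by
      apply h
      ext j
      rw [← fderiv_segreMap_snocZero hF hG, hw', hw]; rfl
    rw [← hw', h1, map_zero]

theorem isNonsingular_segreMap_iff (hF : Differentiable ℝ F)
    (hG : Differentiable ℝ (segreMap F)) : IsNonsingular (segreMap F) ↔ IsNonsingular F := by
  constructor
  · rintro ⟨-, h⟩
    refine ⟨hF, fun x => ?_⟩
    have := (det_fderiv_segreMap_ne_zero_iff hF (hG _)).1 (h (Fin.snoc (α := fun _ => ℝ) x 1))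
    simpa using this
  · rintro ⟨-, h⟩
    exact ⟨hG, fun z => (det_fderiv_segreMap_ne_zero_iff hF (hG z)).2 (h _)⟩

/-! ### Fibers -/

/-- Over `t ≠ 0`, scaling by `t` embeds a fiber into a fiber of `F`; over `t = 0`, injectivity of
`F'(0)` leaves at most one point. The slice `t = 1` gives the other inequality. -/
theorem mfs_segreMap (hF : IsNonsingular F) : mfs (segreMap F) = mfs F := by
  apply le_antisymm
  · refine iSup_le fun w => ?_
    by_cases hw : w (Fin.last n) = 0
    -- The fiber over `F 0` contains `0`, so the supremum for `F` is at least `1`.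
    · refine le_trans ?_ (le_iSup (fun y => (F ⁻¹' {y}).encard) (F 0))
      refine le_trans (b := 1) ?_ (Set.one_le_encard_iff_nonempty.2 ⟨0, rfl⟩)
      refine Set.encard_le_one_iff.2 fun a b ha hb => ?_
      have ha0 : a (Fin.last n) = 0 := by rw [← segreMap_last F a, ha, hw]
      have hb0 : b (Fin.last n) = 0 := by rw [← segreMap_last F b, hb, hw]
      have hab : Fin.init a - Fin.init b = 0 := by
        refine (det_ne_zero_iff_injective _).1 (hF.2 0) _ ?_
        ext j
        rw [map_sub, Pi.sub_apply, ← segreMap_castSucc_of_eq ha0, ← segreMap_castSucc_of_eq hb0,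
          ha, hb, sub_self]
        rfl
      rw [← Fin.snoc_init_self a, ← Fin.snoc_init_self b, sub_eq_zero.1 hab, ha0, hb0]
    · refine le_trans ?_ (le_iSup (fun y => (F ⁻¹' {y}).encard) (w (Fin.last n) • Fin.init w))
      refine Set.encard_le_encard_of_injOn (f := fun z => w (Fin.last n) • Fin.init z) ?_ ?_
      · intro z hz
        have hz0 : z (Fin.last n) = w (Fin.last n) := by rw [← segreMap_last F z, hz]
        change F _ = _
        ext j
        have := congrFun hz j.castSucc
        rw [segreMap_castSucc_of_ne (by rwa [hz0]), hz0] at this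
        rw [Pi.smul_apply, Fin.init, ← this, smul_eq_mul, mul_inv_cancel_left₀ hw]
      · intro a ha b hb hab
        have hab' : Fin.init a = Fin.init b := smul_right_injective _ hw hab
        have ha0 : a (Fin.last n) = w (Fin.last n) := by rw [← segreMap_last F a, ha]
        have hb0 : b (Fin.last n) = w (Fin.last n) := by rw [← segreMap_last F b, hb]
        rw [← Fin.snoc_init_self a, ← Fin.snoc_init_self b, hab', ha0, hb0]
  · refine iSup_le fun y => ?_
    refine le_trans ?_ (le_iSup (fun w => (segreMap F ⁻¹' {w}).encard)
      (Fin.snoc (α := fun _ => ℝ) y 1))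
    refine Set.encard_le_encard_of_injOn (f := fun x => Fin.snoc (α := fun _ => ℝ) x 1) ?_ ?_
    · intro x hx
      change segreMap F _ = _
      ext j
      refine Fin.lastCases ?_ (fun j => ?_) j
      · rw [segreMap_last]; simp
      · rw [segreMap_snoc_one, show F x = y from hx]; simp
    · intro a _ b _ hab
      simpa using congrArg Fin.init hab

/-! ### Component fields -/

open IntermediateField in
-- The generators of `ℝ(G)` become `rᵢ / t` and `t`, which generate the same field as the `rᵢ` and
-- `t`.
theorem map_componentField_segreMap (h0 : F 0 = 0) (hd : DifferentiableAt ℝ F 0)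
    {r : Fin n → RationalFunctions n} (hr : ∀ i, Represents (r i) (fun x => F x i)) :
    (componentField (segreMap F)).map
      (rescaleEquiv n : RationalFunctions (n + 1) →ₐ[ℝ] RatFunc (RationalFunctions n)) =
      RatFunc.adjoinX (componentField F) := by
  choose s hs hsr using fun i => exists_represents_segreMap h0 hd (hr i)
  let s' : Fin (n + 1) → RationalFunctions (n + 1) :=
    Fin.snoc (α := fun _ => RationalFunctions (n + 1)) s
      (algebraMap (MvPolynomial (Fin (n + 1)) ℝ) _ (MvPolynomial.X (Fin.last n)))
  have hs' : ∀ i, Represents (s' i) (fun z => segreMap F z i) := by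
    intro i
    refine Fin.lastCases ?_ (fun i => ?_) i
    · simpa [s'] using represents_segreMap_last F
    · simpa [s'] using hs i
  have hlast : rescaleEquiv n (s' (Fin.last n)) = RatFunc.X := by
    simp only [s', Fin.snoc_last]
    rw [rescaleEquiv_algebraMap, MvPolynomial.aeval_X, rescaledVars_last]
  have hcast : ∀ i : Fin n, rescaleEquiv n (s' i.castSucc) = RatFunc.C (r i) / RatFunc.X := by
    intro i
    simp only [s', Fin.snoc_castSucc]
    exact hsr i
  rw [componentField_eq hr, componentField_eq hs', adjoin_map, RatFunc.adjoinX_adjoin]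
  apply le_antisymm
  · rw [adjoin_le_iff]
    have hX : (RatFunc.X : RatFunc (RationalFunctions n)) ∈
        adjoin ℝ (insert RatFunc.X (RatFunc.C '' Set.range r)) :=
      subset_adjoin _ _ (Set.mem_insert _ _)
    rintro _ ⟨_, ⟨i, rfl⟩, rfl⟩
    refine Fin.lastCases ?_ (fun i => ?_) i
    · exact hlast ▸ hX
    · change rescaleEquiv n (s' i.castSucc) ∈ _
      rw [hcast]
      exact div_mem (subset_adjoin _ _ (Set.mem_insert_of_mem _ ⟨_, ⟨i, rfl⟩, rfl⟩)) hX
  · rw [adjoin_le_iff]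
    have hX : (RatFunc.X : RatFunc (RationalFunctions n)) ∈
        adjoin ℝ ((rescaleEquiv n : RationalFunctions (n + 1) →ₐ[ℝ] RatFunc (RationalFunctions n)) ''
          Set.range s') :=
      subset_adjoin _ _ ⟨_, ⟨Fin.last n, rfl⟩, hlast⟩
    rintro _ (rfl | ⟨_, ⟨i, rfl⟩, rfl⟩)
    · exact hX
    · have h1 : RatFunc.C (r i) / RatFunc.X ∈
          adjoin ℝ ((rescaleEquiv n : RationalFunctions (n + 1) →ₐ[ℝ]
            RatFunc (RationalFunctions n)) '' Set.range s') :=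
        subset_adjoin _ _ ⟨_, ⟨i.castSucc, rfl⟩, hcast i⟩
      have h2 := mul_mem h1 hX
      rwa [div_mul_cancel₀ _ RatFunc.X_ne_zero] at h2

theorem dex_segreMap_and_sag_segreMap (hF : AnalyticOnNhd ℝ F Set.univ) (h0 : F 0 = 0)
    (hrat : IsEverywhereDefinedRational F) (hns : IsNonsingular F) :
    dex (segreMap F) = dex F ∧ sag (segreMap F) = sag F := by
  choose r hr using hrat
  have halg := isAlgebraic_componentField hF hr (hns.2 0)
  have hmap := map_componentField_segreMap h0 (hF 0 trivial).differentiableAt hr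
  constructor
  · exact (IntermediateField.rank_eq_of_map_eq (rescaleEquiv n) hmap).trans
      (RatFunc.rank_adjoinX _)
  · exact (Cardinal.mk_congr (IntermediateField.autEquivOfMapEq (rescaleEquiv n) hmap)).trans
      (Cardinal.mk_congr (Equiv.ofBijective _ (RatFunc.extendAut_bijective _))).symm

end RealMap

theorem mainTheorem4 (F G : RealMap.AnalyticEndo) (h : RealMap.SegreEquivalent F G) :
    ((RealMap.IsEverywhereDefinedRational F.map ∧ RealMap.IsNonsingular F.map) ↔
      (RealMap.IsEverywhereDefinedRational G.map ∧ RealMap.IsNonsingular G.map)) ∧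
    ((RealMap.IsEverywhereDefinedRational F.map ∧ RealMap.IsNonsingular F.map) →
      RealMap.dex F.map = RealMap.dex G.map ∧
      RealMap.sag F.map = RealMap.sag G.map ∧
      RealMap.mfs F.map = RealMap.mfs G.map) := by
  induction h with
  | rel F _ h =>
    obtain ⟨hpos, han, hzero⟩ := h
    have hF : Differentiable ℝ F.map := fun x => (F.analytic x trivial).differentiableAt
    have hG : Differentiable ℝ (RealMap.segreMap F.map) :=
      fun x => (han x trivial).differentiableAt
    refine ⟨and_congr (RealMap.isEverywhereDefinedRational_segreMap_iff F.map_zero (hF 0)).symm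
      (RealMap.isNonsingular_segreMap_iff hF hG).symm, fun h => ?_⟩
    obtain ⟨h1, h2⟩ := RealMap.dex_segreMap_and_sag_segreMap F.analytic F.map_zero h.1 h.2
    exact ⟨h1.symm, h2.symm, (RealMap.mfs_segreMap h.2).symm⟩
  | refl F => exact ⟨Iff.rfl, fun _ => ⟨rfl, rfl, rfl⟩⟩
  | symm F G _ ih =>
    refine ⟨ih.1.symm, fun h => ?_⟩
    -- The invariants are compared only for rational nonsingular maps, so the equivalence of that
    -- property must be part of the induction.
    obtain ⟨h1, h2, h3⟩ := ih.2 (ih.1.2 h)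
    exact ⟨h1.symm, h2.symm, h3.symm⟩
  | trans F G H _ _ ih1 ih2 =>
    refine ⟨ih1.1.trans ih2.1, fun h => ?_⟩
    obtain ⟨h1, h2, h3⟩ := ih1.2 h
    obtain ⟨h4, h5, h6⟩ := ih2.2 (ih1.1.1 h)
    exact ⟨h1.trans h4, h2.trans h5, h3.trans h6⟩
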